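/- Take the triangular lattice with a system of coordinates whose $i$-axis runs along a horizontal lattice line with unit half the length of a lattice edge, whose $j$-axis is perpendicular to it at a lattice vertex (the origin), with unit the height of a unit triangle. Let $x,n\ge 0$ be integers and let $1\le s_1<s_2<\dots<s_n\le n+x$ be integers. Consider the right trapezoidal region with side-lengths $x,\,2n,\,x+n,\,2n$ (counter-clockwise from the north side), whose base runs along the $i$-axis from $(0,0)$ to $(2(x+n),0)$, whose west side is the vertical zigzag $(0,0),(-1,1),(0,2),(-1,3),\dots,(0,2n)$, and whose northeast side runs along a lattice line from $(2(x+n),0)$ to $(2x,2n)$. Remove from it the up-pointing unit triangles at the positions $s_1,\dots,s_n$ (counted from left to right) along the base. Weight each vertical lozenge with center $(i,j)$ by $\frac{q^{i}+q^{-i}}{2}$ if $i\ne 0$ and by $\frac12$ if $i=0$ (that is, if the $j$-axis passes through its center), and every other lozenge by $1$; the weight of a lozenge tiling is the product of the weights of its lozenges. Denote the resulting weighted region by $R^4_x(s_1,\dots,s_n)$ and by $\operatorname{M}(R^4_x(s_1,\dots,s_n))$ the sum of the weights of all its lozenge tilings (which is $1$ for the empty region, $n=0$). Write $[m]_q=1+q+\dots+q^{m-1}$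 and $[m]_q!=[1]_q[2]_q\cdots[m]_q$. Then, as rational functions of the indeterminate $q$ over $\mathbb{Q}$, \begin{align*} \operatorname{M}(R^{4}_{x}(s_1,\dots,s_n))&=2^{-n^2}q^{-\sum_{i=1}^n((4i-2)s_i-2i^2-i+1)}\, \frac{\prod_{i=1}^{n}[2s_i-1]_{q^2}\prod_{1\leq i < j\leq n}[2(s_i+s_j-1)]_{q^2}[2(s_j-s_i)]_{q^2}}{\prod_{i=1}^{n}[2i-1]_{q^2}!}\\ &=2^{-n^2}q^{-\sum_{i=1}^n((4i-2)s_i-2i^2-i+1)}\prod_{i=1}^{n}\frac{1}{q^{4s_i-2}+1}\prod_{1\leq i \leq j\leq n}\frac{[2(s_i+s_j-1)]_{q^2}}{[i+j-1]_{q^2}} \prod_{1\leq i < j\leq n}\frac{[2(s_j-s_i)]_{q^2}}{[j-i]_{q^2}}. \end{align*} -/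

import Mathlib

/-! Coordinates: on the triangular lattice take the horizontal unit to be half the edge of a lozenge
and the vertical unit to be the height of a unit triangle.  The lattice vertices are then the integer
points `(i, j)` with `i + j` even. -/

/-- A unit triangle `(a, r)` of the triangular lattice: it lies in the horizontal strip
`r ≤ j ≤ r + 1`, and its vertical symmetry axis is the line `i = a`. -/
abbrev UnitTriangle : Type := ℤ × ℤ

/-- The triangle points up: its vertices are `(a - 1, r)`, `(a + 1, r)` and `(a, r + 1)`. -/
def UnitTriangle.IsUp (t : UnitTriangle) : Prop := Odd (t.1 + t.2)

/-- The triangle points down: its vertices are `(a - 1, r + 1)`, `(a + 1, r + 1)` and `(a, r)`. -/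
def UnitTriangle.IsDown (t : UnitTriangle) : Prop := Even (t.1 + t.2)

open Classical in
/-- The three vertices of a unit triangle. -/
noncomputable def UnitTriangle.vertices (t : UnitTriangle) : Finset (ℤ × ℤ) :=
  if t.IsUp then {(t.1 - 1, t.2), (t.1 + 1, t.2), (t.1, t.2 + 1)}
  else {(t.1 - 1, t.2 + 1), (t.1 + 1, t.2 + 1), (t.1, t.2)}

/-- A pair of unit triangles `L = (d, u)` is a lozenge: `d` points down, `u` points up, and they share
an edge, so that `u` is the left or right neighbour of `d` in the same strip, or `u` sits on the
horizontal edge on top of `d`. -/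
def IsLozenge (L : UnitTriangle × UnitTriangle) : Prop :=
  L.1.IsDown ∧ L.2.IsUp ∧
    (L.2 = (L.1.1 - 1, L.1.2) ∨ L.2 = (L.1.1 + 1, L.1.2) ∨ L.2 = (L.1.1, L.1.2 + 1))

open Classical in
/-- The lozenge tilings of a finite region (a finite set of unit triangles): sets of lozenges inside
the region such that each unit triangle of the region belongs to exactly one of them. -/
noncomputable def lozengeTilings (R : Finset UnitTriangle) :
    Finset (Finset (UnitTriangle × UnitTriangle)) :=
  (R ×ˢ R).powerset.filter fun T =>
    (∀ L ∈ T, IsLozenge L) ∧ ∀ t ∈ R, ∃! L, L ∈ T ∧ (t = L.1 ∨ t = L.2)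

/-- The tiling generating function of a weighted region: the sum over all tilings of the product of
the weights of the lozenges. -/
noncomputable def tilingGF {K : Type*} [Field K] (R : Finset UnitTriangle)
    (wt : UnitTriangle × UnitTriangle → K) : K :=
  ∑ T ∈ lozengeTilings R, ∏ L ∈ T, wt L

/-- The weight `wt₂`.  A vertical lozenge (two triangles with the same symmetry axis) with center
`(i, j)` has weight `(q ^ i + q ^ (-i)) / 2`, except that it has weight `1 / 2` when it is cut by the
`j`-axis, i.e. `i = 0`.  The other lozenges have weight `1`. -/
noncomputable def wt₂ {K : Type*} [Field K] (q : K) (L : UnitTriangle × UnitTriangle) : K :=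
  if L.1.1 = L.2.1 then
    if L.1.1 = 0 then 1 / 2 else (q ^ L.1.1 + q ^ (-L.1.1)) / 2
  else 1

/-- The abscissa of the vertical zigzag on the west at integer height `j`: the zigzag starts at the
origin and runs through `(0, 0), (-1, 1), (0, 2), (-1, 3), …`. -/
def westEnd (j : ℤ) : ℤ := if Even j then 0 else -1

/-- The abscissa of the northeast side at height `j`: it runs along a lattice line from the right end
`(2 * (x + n), 0)` of the base. -/
def eastEnd (x n : ℕ) (j : ℤ) : ℤ := 2 * (x + n) - j

open Classical in
/-- The right trapezoidal region with side-lengths `x, 2 * n, x + n, 2 * n` (from the north side,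
counter-clockwise), with the base on the `i`-axis. A unit triangle lies in it iff its vertices do. -/
noncomputable def trapezoid (x n : ℕ) : Finset UnitTriangle :=
  (Finset.Icc (-1 : ℤ) (2 * (x + n)) ×ˢ Finset.Ico (0 : ℤ) (2 * n)).filter fun t =>
    ∀ v ∈ t.vertices, westEnd v.2 ≤ v.1 ∧ v.1 ≤ eastEnd x n v.2

/-- The `p`-th up-pointing unit triangle along the base, from left to right, `p = 1, 2, …`. -/
def baseTriangle (p : ℕ) : UnitTriangle := (2 * (p : ℤ) - 1, 0)

/-- The quartered hexagon: the trapezoid with dents at the positions `s 1, …, s n` of the base. -/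
noncomputable def quarteredHexagon (x n : ℕ) (s : ℕ → ℕ) : Finset UnitTriangle :=
  trapezoid x n \ (Finset.Icc 1 n).image fun i => baseTriangle (s i)

/-- The `q`-integer `[m]_q = 1 + q + ⋯ + q ^ (m - 1)`. -/
def qInt {K : Type*} [Field K] (q : K) (m : ℕ) : K := ∑ k ∈ Finset.range m, q ^ k

/-- The `q`-factorial `[m]_q! = [1]_q [2]_q ⋯ [m]_q`. -/
def qFactorial {K : Type*} [Field K] (q : K) (m : ℕ) : K := ∏ k ∈ Finset.Icc 1 m, qInt q k

/-!
Scan the region strip by strip from the bottom. The vertical lozenges that cross the top of a strip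
are the dents of the region above it; they interlace with the dents of the strip and determine its
tiling. Hence the generating function is an iterated sum over interlacing sequences. Each of these
sums can be carried out: a determinant whose `i`-th row is `G (t i + 1) - G (t i)` telescopes when
summed over the sequences `t` that interlace with `b`, to the determinant with rows
`G (b (i + 1)) - G (b i)`. For `G` built from `sinh ((2 j + 1) u)` or `cosh (2 j u)`, where
`q = exp u`, the three-term recurrences of the hyperbolic functions turn both determinants into
Vandermonde determinants in `2 cosh`, so two consecutive strips reproduce the formula with one dent
fewer, up to a constant factor.
-/

section Tilings

variable {K : Type*} [Field K] {R : Finset UnitTriangle} {t : UnitTriangle}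
  {L L' : UnitTriangle × UnitTriangle} {T : Finset (UnitTriangle × UnitTriangle)}

theorem mem_lozengeTilings : T ∈ lozengeTilings R ↔
    (∀ L ∈ T, L.1 ∈ R ∧ L.2 ∈ R) ∧ (∀ L ∈ T, IsLozenge L) ∧
      ∀ t ∈ R, ∃! L, L ∈ T ∧ (t = L.1 ∨ t = L.2) := by
  simp only [lozengeTilings, Finset.mem_filter, Finset.mem_powerset, Finset.subset_iff,
    Finset.mem_product]

theorem eq_of_mem_lozengeTilings (hT : T ∈ lozengeTilings R) (hL : L ∈ T) (hL' : L' ∈ T)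
    (ht : t = L.1 ∨ t = L.2) (ht' : t = L'.1 ∨ t = L'.2) : L = L' := by
  obtain ⟨hsub, -, hcover⟩ := mem_lozengeTilings.1 hT
  have htR : t ∈ R := by
    rcases ht with rfl | rfl
    exacts [(hsub L hL).1, (hsub L hL).2]
  exact (hcover t htR).unique ⟨hL, ht⟩ ⟨hL', ht'⟩

theorem notMem_of_mem_lozengeTilings_sdiff (hT : T ∈ lozengeTilings (R \ {L.1, L.2})) : L ∉ T := by
  intro hL
  simpa using ((mem_lozengeTilings.1 hT).1 L hL).1

theorem insert_mem_lozengeTilings (hL : IsLozenge L) (h₁ : L.1 ∈ R) (h₂ : L.2 ∈ R)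
    (hT : T ∈ lozengeTilings (R \ {L.1, L.2})) : insert L T ∈ lozengeTilings R := by
  obtain ⟨hsub, hloz, hcover⟩ := mem_lozengeTilings.1 hT
  simp only [Finset.mem_sdiff, Finset.mem_insert, Finset.mem_singleton, not_or] at hsub hcover
  refine mem_lozengeTilings.2 ⟨?_, Finset.forall_mem_insert _ _ _ |>.2 ⟨hL, hloz⟩, fun t ht => ?_⟩
  · exact Finset.forall_mem_insert _ _ _ |>.2
      ⟨⟨h₁, h₂⟩, fun L' hL' => ⟨(hsub L' hL').1.1, (hsub L' hL').2.1⟩⟩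
  by_cases htL : t = L.1 ∨ t = L.2
  · refine ⟨L, ⟨Finset.mem_insert_self _ _, htL⟩, ?_⟩
    rintro L' ⟨hL', ht'⟩
    refine (Finset.mem_insert.1 hL').resolve_right fun hL'T => ?_
    have := hsub L' hL'T
    grind
  · obtain ⟨L', ⟨hL', ht'⟩, huniq⟩ := hcover t ⟨ht, by tauto⟩
    refine ⟨L', ⟨Finset.mem_insert_of_mem hL', ht'⟩, ?_⟩
    rintro L'' ⟨hL'', ht''⟩
    rcases Finset.mem_insert.1 hL'' with rfl | hL''
    exacts [absurd ht'' htL, huniq L'' ⟨hL'', ht''⟩]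

theorem erase_mem_lozengeTilings [DecidableEq (UnitTriangle × UnitTriangle)]
    (hT : T ∈ lozengeTilings R) (hL : L ∈ T) :
    T.erase L ∈ lozengeTilings (R \ {L.1, L.2}) := by
  obtain ⟨hsub, hloz, hcover⟩ := mem_lozengeTilings.1 hT
  refine mem_lozengeTilings.2
    ⟨fun L' hL' => ?_, fun L' hL' => hloz L' (Finset.mem_of_mem_erase hL'), fun t ht => ?_⟩
  · obtain ⟨hne, hL'⟩ := Finset.mem_erase.1 hL'
    simp only [Finset.mem_sdiff, Finset.mem_insert, Finset.mem_singleton]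
    exact ⟨⟨(hsub L' hL').1, fun h => hne (eq_of_mem_lozengeTilings hT hL' hL (Or.inl rfl) h)⟩,
      ⟨(hsub L' hL').2, fun h => hne (eq_of_mem_lozengeTilings hT hL' hL (Or.inr rfl) h)⟩⟩
  · simp only [Finset.mem_sdiff, Finset.mem_insert, Finset.mem_singleton] at ht
    obtain ⟨L', ⟨hL', ht'⟩, huniq⟩ := hcover t ht.1
    refine ⟨L', ⟨Finset.mem_erase.2 ⟨?_, hL'⟩, ht'⟩, ?_⟩
    · rintro rfl
      exact ht.2 ht'
    · rintro L'' ⟨hL'', ht''⟩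
      exact huniq L'' ⟨Finset.mem_of_mem_erase hL'', ht''⟩

theorem tilingGF_empty (wt : UnitTriangle × UnitTriangle → K) : tilingGF ∅ wt = 1 := by
  have : lozengeTilings ∅ = {∅} := by
    ext T
    simp only [mem_lozengeTilings, Finset.notMem_empty, and_self, imp_false, false_imp_iff,
      implies_true, and_true, Finset.mem_singleton, ← Finset.eq_empty_iff_forall_notMem]
    exact and_iff_left_of_imp (by rintro rfl; simp)
  simp [tilingGF, this]

open Classical in
theorem tilingGF_eq_sum_lozenge (ht : t ∈ R) (wt : UnitTriangle × UnitTriangle → K) :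
    tilingGF R wt =
      ∑ L ∈ (R ×ˢ R).filter (fun L => IsLozenge L ∧ (t = L.1 ∨ t = L.2)),
        wt L * tilingGF (R \ {L.1, L.2}) wt := by
  simp only [tilingGF, Finset.mul_sum]
  rw [Finset.sum_sigma']
  symm
  refine Finset.sum_bij (fun p _ => insert p.1 p.2) ?_ ?_ ?_ ?_
  · rintro ⟨L, T⟩ hp
    simp only [Finset.mem_sigma, Finset.mem_filter, Finset.mem_product] at hp
    exact insert_mem_lozengeTilings hp.1.2.1 hp.1.1.1 hp.1.1.2 hp.2
  · rintro ⟨L, T⟩ hp ⟨L', T'⟩ hp' h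
    simp only [Finset.mem_sigma, Finset.mem_filter, Finset.mem_product] at hp hp' h
    have hT := insert_mem_lozengeTilings hp.1.2.1 hp.1.1.1 hp.1.1.2 hp.2
    obtain rfl : L = L' := eq_of_mem_lozengeTilings hT (Finset.mem_insert_self _ _)
      (h ▸ Finset.mem_insert_self _ _) hp.1.2.2 hp'.1.2.2
    have := congrArg (fun s => Finset.erase s L) h
    simp only [Finset.erase_insert (notMem_of_mem_lozengeTilings_sdiff hp.2),
      Finset.erase_insert (notMem_of_mem_lozengeTilings_sdiff hp'.2)] at this
    rw [this]
  · intro T hT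
    obtain ⟨hsub, hloz, hcover⟩ := mem_lozengeTilings.1 hT
    obtain ⟨L, ⟨hL, htL⟩, -⟩ := hcover t ht
    refine ⟨⟨L, T.erase L⟩, ?_, Finset.insert_erase hL⟩
    simp only [Finset.mem_sigma, Finset.mem_filter, Finset.mem_product]
    exact ⟨⟨hsub L hL, hloz L hL, htL⟩, erase_mem_lozengeTilings hT hL⟩
  · rintro ⟨L, T⟩ hp
    simp only [Finset.mem_sigma] at hp
    rw [Finset.prod_insert (notMem_of_mem_lozengeTilings_sdiff hp.2)]

theorem tilingGF_eq_sum_of_isDown (ht : t.IsDown) (htR : t ∈ R)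
    (wt : UnitTriangle × UnitTriangle → K) :
    tilingGF R wt =
      ∑ u ∈ {(t.1 - 1, t.2), (t.1 + 1, t.2), (t.1, t.2 + 1)},
        if u ∈ R then wt (t, u) * tilingGF (R \ {t, u}) wt else 0 := by
  classical
  rw [tilingGF_eq_sum_lozenge htR, ← Finset.sum_filter]
  refine Finset.sum_nbij' Prod.snd (Prod.mk t) ?_ ?_ ?_ ?_ ?_ <;>
    simp only [UnitTriangle.IsDown, UnitTriangle.IsUp, IsLozenge] at * <;> grind

theorem tilingGF_eq_sum_of_isUp (ht : t.IsUp) (htR : t ∈ R)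
    (wt : UnitTriangle × UnitTriangle → K) :
    tilingGF R wt =
      ∑ d ∈ {(t.1 - 1, t.2), (t.1 + 1, t.2), (t.1, t.2 - 1)},
        if d ∈ R then wt (d, t) * tilingGF (R \ {d, t}) wt else 0 := by
  classical
  rw [tilingGF_eq_sum_lozenge htR, ← Finset.sum_filter]
  refine Finset.sum_nbij' Prod.fst (Prod.mk · t) ?_ ?_ ?_ ?_ ?_ <;>
    simp only [UnitTriangle.IsDown, UnitTriangle.IsUp, IsLozenge] at * <;> grind

end Tilings

/-- The part of a region that is left over when the strip `r ≤ j ≤ r + 1` has been scanned from left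
to right up to the abscissa `a`: the triangles of that strip left of `a` are deleted. -/
def trimStrip (R : Finset UnitTriangle) (r a : ℤ) : Finset UnitTriangle :=
  R.filter fun t => t.2 = r → a ≤ t.1

section Strip

variable {K : Type*} [Field K] {R : Finset UnitTriangle} {r a : ℤ} {c p N : ℕ} {e : ℤ}
  {wt : UnitTriangle × UnitTriangle → K}

theorem mem_trimStrip {t : UnitTriangle} : t ∈ trimStrip R r a ↔ t ∈ R ∧ (t.2 = r → a ≤ t.1) :=
  Finset.mem_filter

theorem trimStrip_eq_self (h : ∀ t ∈ R, t.2 = r → a ≤ t.1) : trimStrip R r a = R :=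
  Finset.filter_eq_self.2 h

theorem trimStrip_add_one (h : (a, r) ∉ R) : trimStrip R r (a + 1) = trimStrip R r a := by
  ext ⟨b, j⟩
  simp only [mem_trimStrip]
  grind

theorem trimStrip_add_two (a r : ℤ) :
    trimStrip R r a \ {(a, r), (a + 1, r)} = trimStrip R r (a + 2) := by
  ext ⟨b, j⟩
  simp only [mem_trimStrip, Finset.mem_sdiff, Finset.mem_insert, Finset.mem_singleton,
    Prod.mk.injEq]
  grind

theorem trimStrip_sdiff_vertical (a r : ℤ) :
    trimStrip R r a \ {(a, r), (a, r + 1)} = trimStrip (R.erase (a, r + 1)) r (a + 1) := by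
  ext ⟨b, j⟩
  simp only [mem_trimStrip, Finset.mem_sdiff, Finset.mem_insert, Finset.mem_singleton,
    Finset.mem_erase, Prod.mk.injEq, ne_eq]
  grind

theorem tilingGF_trimStrip_of_isDown (hwt : ∀ L, L.1.1 ≠ L.2.1 → wt L = 1) (ha : Even (a + r))
    (haR : (a, r) ∈ R) :
    tilingGF (trimStrip R r a) wt =
      (if (a + 1, r) ∈ R then tilingGF (trimStrip R r (a + 2)) wt else 0) +
        if (a, r + 1) ∈ R then
          wt ((a, r), (a, r + 1)) * tilingGF (trimStrip (R.erase (a, r + 1)) r (a + 1)) wt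
        else 0 := by
  rw [tilingGF_eq_sum_of_isDown (t := (a, r)) ha (mem_trimStrip.2 ⟨haR, fun _ => le_rfl⟩),
    Finset.sum_insert (by grind), Finset.sum_pair (by simp)]
  simp only [mem_trimStrip, trimStrip_add_two, trimStrip_sdiff_vertical]
  rw [hwt ((a, r), (a + 1, r)) (by simp)]
  simp

theorem tilingGF_trimStrip_of_isUp (hwt : ∀ L, L.1.1 ≠ L.2.1 → wt L = 1)
    (hR : ∀ t ∈ R, r ≤ t.2) (ha : Odd (a + r)) (haR : (a, r) ∈ R) :
    tilingGF (trimStrip R r a) wt =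
      if (a + 1, r) ∈ R then tilingGF (trimStrip R r (a + 2)) wt else 0 := by
  have hbelow : (a, r - 1) ∉ R := fun h => by simpa using hR _ h
  rw [tilingGF_eq_sum_of_isUp (t := (a, r)) ha (mem_trimStrip.2 ⟨haR, fun _ => le_rfl⟩),
    Finset.sum_insert (by grind), Finset.sum_pair (by simp)]
  simp only [mem_trimStrip, Finset.pair_comm _ (a, r), trimStrip_add_two]
  rw [hwt ((a + 1, r), (a, r)) (by simp)]
  simp [hbelow]

theorem tilingGF_trimStrip_add_two_mul (hwt : ∀ L, L.1.1 ≠ L.2.1 → wt L = 1)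
    (hR : ∀ t ∈ R, r ≤ t.2) (ha : Odd (a + r)) (k : ℕ)
    (hfull : ∀ b, a ≤ b → b < a + 2 * k → (b, r) ∈ R) :
    tilingGF (trimStrip R r a) wt = tilingGF (trimStrip R r (a + 2 * k)) wt := by
  induction k generalizing a with
  | zero => simp
  | succ k ih =>
    rw [tilingGF_trimStrip_of_isUp hwt hR ha (hfull a le_rfl (by omega)),
      if_pos (hfull (a + 1) (by omega) (by omega)),
      ih (by grind) fun b _ _ => hfull b (by omega) (by push_cast; omega)]
    congr 2
    push_cast
    ring

theorem tilingGF_trimStrip_eq_sum_of_dent (hwt : ∀ L, L.1.1 ≠ L.2.1 → wt L = 1)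
    (hR : ∀ t ∈ R, r ≤ t.2) (he : Even (e + r)) (hcp : c < p)
    (hfull : ∀ a, 2 * c + e ≤ a → a < 2 * p + e - 1 → (a, r) ∈ R)
    (hdent : (2 * p + e - 1, r) ∉ R)
    (htop : ∀ j ∈ Finset.Ico c p, ((2 * j + e, r + 1) : UnitTriangle) ∈ R) :
    tilingGF (trimStrip R r (2 * c + e)) wt =
      ∑ j ∈ Finset.Ico c p, wt ((2 * j + e, r), (2 * j + e, r + 1)) *
        tilingGF (trimStrip (R.erase (2 * j + e, r + 1)) r (2 * p + e)) wt := by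
  induction hk : p - c generalizing c with
  | zero => omega
  | succ k ih =>
    have hvert : tilingGF (trimStrip (R.erase (2 * c + e, r + 1)) r (2 * c + e + 1)) wt =
        tilingGF (trimStrip (R.erase (2 * c + e, r + 1)) r (2 * p + e)) wt := by
      rw [tilingGF_trimStrip_add_two_mul hwt (fun t ht => hR t (Finset.mem_of_mem_erase ht))
          (by grind) (p - c - 1)
          fun b _ _ => Finset.mem_erase.2 ⟨by simp, hfull b (by omega) (by omega)⟩,
        show 2 * (c : ℤ) + e + 1 + 2 * ((p - c - 1 : ℕ) : ℤ) = 2 * p + e - 1 by omega,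
        ← trimStrip_add_one (by simp [hdent]), sub_add_cancel]
    rw [tilingGF_trimStrip_of_isDown hwt (by grind) (hfull _ le_rfl (by omega)),
      if_pos (htop c (by simpa)), hvert, Finset.sum_eq_sum_Ico_succ_bot hcp, add_comm]
    congr 1
    rcases (show c + 1 ≤ p from hcp).eq_or_lt with hcp' | hcp'
    · subst hcp'
      rw [if_neg (by convert hdent using 3; push_cast; ring)]
      simp
    · rw [if_pos (hfull _ (by omega) (by omega)), ← ih hcp'
        (fun a _ _ => hfull a (by omega) (by omega)) (fun j hj => htop j (by grind)) (by omega)]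
      congr 2
      push_cast
      ring

theorem tilingGF_trimStrip_of_forall_notMem (hwt : ∀ L, L.1.1 ≠ L.2.1 → wt L = 1)
    (hR : ∀ t ∈ R, r ≤ t.2) (he : Even (e + r)) (hcN : c ≤ N)
    (hrow : ∀ a, 2 * c + e ≤ a → ((a, r) ∈ R ↔ a < 2 * N + e)) :
    tilingGF (trimStrip R r (2 * c + e)) wt = tilingGF (R.filter (r < ·.2)) wt := by
  induction hk : N - c generalizing c with
  | zero =>
    congr 1
    ext ⟨a, j⟩
    have := hR (a, j)
    have := hrow a
    simp only [mem_trimStrip, Finset.mem_filter]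
    grind
  | succ k ih =>
    have hvert : tilingGF (trimStrip (R.erase (2 * c + e, r + 1)) r (2 * c + e + 1)) wt = 0 := by
      have hR' : ∀ t ∈ R.erase (2 * c + e, r + 1), r ≤ t.2 :=
        fun t ht => hR t (Finset.mem_of_mem_erase ht)
      rw [tilingGF_trimStrip_add_two_mul hwt hR' (by grind) (N - c - 1)
          fun b _ _ => Finset.mem_erase.2 ⟨by simp, (hrow b (by omega)).2 (by omega)⟩,
        tilingGF_trimStrip_of_isUp hwt hR' (by grind)
          (Finset.mem_erase.2 ⟨by simp, (hrow _ (by omega)).2 (by omega)⟩), if_neg]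
      simp only [Finset.mem_erase, not_and]
      exact fun _ h => by have := (hrow _ (by omega)).1 h; omega
    rw [tilingGF_trimStrip_of_isDown hwt (by grind) ((hrow _ le_rfl).2 (by omega)), hvert,
      if_pos ((hrow _ (by omega)).2 (by omega)), mul_zero, ite_self, add_zero,
      ← ih (c := c + 1) (by omega) (fun a _ => hrow a (by push_cast at *; omega)) (by omega)]
    congr 2
    push_cast
    ring

end Strip

/-- The sequences `t` that interlace with `b`, i.e. `b 0 ≤ t 0 < b 1 ≤ t 1 < b 2 ≤ ⋯ < b n`. -/
def interlacing {n : ℕ} (b : Fin (n + 1) → ℕ) : Finset (Fin n → ℕ) :=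
  Fintype.piFinset fun i => Finset.Ico (b i.castSucc) (b i.succ)

theorem mem_interlacing {n : ℕ} {b : Fin (n + 1) → ℕ} {t : Fin n → ℕ} :
    t ∈ interlacing b ↔ ∀ i, b i.castSucc ≤ t i ∧ t i < b i.succ := by
  simp only [interlacing, Fintype.mem_piFinset, Finset.mem_Ico]

theorem strictMono_of_mem_interlacing {n : ℕ} {b : Fin (n + 1) → ℕ} (hb : Monotone b)
    {t : Fin n → ℕ} (ht : t ∈ interlacing b) : StrictMono t := fun i j hij =>
  calc t i < b i.succ := (mem_interlacing.1 ht i).2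
    _ ≤ b j.castSucc := hb (Fin.succ_le_castSucc_iff.2 hij)
    _ ≤ t j := (mem_interlacing.1 ht j).1

theorem sum_interlacing_succ {M : Type*} [AddCommMonoid M] {n : ℕ} (b : Fin (n + 2) → ℕ)
    (f : (Fin (n + 1) → ℕ) → M) :
    ∑ t ∈ interlacing b, f t =
      ∑ j ∈ Finset.Ico (b 0) (b 1), ∑ t ∈ interlacing (Fin.tail b), f (Fin.cons j t) := by
  rw [Finset.sum_sigma']
  refine Finset.sum_bij' (fun t _ => ⟨t 0, Fin.tail t⟩) (fun p _ => Fin.cons p.1 p.2) ?_ ?_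
    (by simp) (by simp) (by simp) <;>
    simp only [Finset.mem_sigma, mem_interlacing, Fin.forall_fin_succ, Finset.mem_Ico] <;>
    exact fun _ h => h

theorem tilingGF_trimStrip_eq_sum_interlacing {K : Type*} [Field K]
    {wt : UnitTriangle × UnitTriangle → K} (hwt : ∀ L, L.1.1 ≠ L.2.1 → wt L = 1)
    {R : Finset UnitTriangle} {r e : ℤ} (hR : ∀ t ∈ R, r ≤ t.2) (he : Even (e + r))
    {n N : ℕ} {b : Fin (n + 1) → ℕ} (hb : StrictMono b) (hbN : b (Fin.last n) ≤ N)
    (hrow : ∀ a, 2 * b 0 + e ≤ a →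
      ((a, r) ∈ R ↔ a < 2 * N + e ∧ ∀ i : Fin n, a ≠ 2 * b i.succ + e - 1))
    (htop : ∀ j ∈ Finset.Ico (b 0) (b (Fin.last n)), ((2 * j + e, r + 1) : UnitTriangle) ∈ R) :
    tilingGF (trimStrip R r (2 * b 0 + e)) wt =
      ∑ t ∈ interlacing b, (∏ i, wt ((2 * t i + e, r), (2 * t i + e, r + 1))) *
        tilingGF (R.filter (r < ·.2) \
          Finset.univ.image fun i => ((2 * t i + e, r + 1) : UnitTriangle)) wt := by
  induction n generalizing R with
  | zero =>
    rw [tilingGF_trimStrip_of_forall_notMem (c := b 0) hwt hR he hbN (by simpa using hrow)]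
    simp [interlacing]
  | succ n ih =>
    have hb01 : b 0 < b 1 := hb (Fin.succ_pos 0)
    have hb1 : ∀ i : Fin (n + 1), b 1 ≤ b i.succ := fun i =>
      hb.monotone (Fin.succ_le_succ_iff.2 (Fin.zero_le i))
    have hlast : b 1 ≤ b (Fin.last (n + 1)) := hb1 (Fin.last n)
    rw [tilingGF_trimStrip_eq_sum_of_dent hwt hR he hb01
        (fun a ha _ => (hrow a ha).2 ⟨by omega, fun i => by have := hb1 i; omega⟩)
        (fun h => ((hrow _ (by omega)).1 h).2 0 (by simp))
        (fun j hj => htop j (Finset.Ico_subset_Ico_right hlast hj)),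
      sum_interlacing_succ]
    refine Finset.sum_congr rfl fun j hj => ?_
    have hj1 : j < b 1 := (Finset.mem_Ico.1 hj).2
    have hrow' : ∀ a, 2 * b 1 + e ≤ a → ((a, r) ∈ R.erase (2 * (j : ℤ) + e, r + 1) ↔
        a < 2 * N + e ∧ ∀ i : Fin n, a ≠ 2 * b i.succ.succ + e - 1) := fun a ha => by
      have hne : a ≠ 2 * b 1 + e - 1 := by omega
      rw [Finset.mem_erase, hrow a (by omega), Fin.forall_fin_succ]
      simp [hne]
    have htop' : ∀ j' ∈ Finset.Ico (b 1) (b (Fin.last (n + 1))),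
        ((2 * j' + e, r + 1) : UnitTriangle) ∈ R.erase (2 * (j : ℤ) + e, r + 1) := fun j' hj' => by
      rw [Finset.mem_Ico] at hj'
      exact Finset.mem_erase.2
        ⟨by simp only [ne_eq, Prod.mk.injEq]; omega, htop j' (Finset.mem_Ico.2 (by omega))⟩
    have htail := ih (b := Fin.tail b) (fun t ht => hR t (Finset.mem_of_mem_erase ht))
      (fun i j hij => hb (Fin.succ_lt_succ_iff.2 hij)) hbN hrow' htop'
    rw [show b 1 = Fin.tail b 0 from rfl, htail, Finset.mul_sum]
    refine Finset.sum_congr rfl fun t _ => ?_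
    rw [Fin.prod_univ_succ, mul_assoc, Finset.filter_erase, ← Finset.sdiff_singleton_eq_erase,
      sdiff_sdiff_left, Fin.univ_succ, Finset.cons_eq_insert, Finset.image_insert,
      Finset.map_eq_image, Finset.image_image]
    rfl

section Determinant

variable {A : Type*} [CommRing A] {n : ℕ}

theorem sum_interlacing_det_sub {b : Fin (n + 1) → ℕ} (hb : Monotone b) (G : ℕ → Fin n → A) :
    ∑ t ∈ interlacing b, (Matrix.of fun i => G (t i + 1) - G (t i)).det =
      (Matrix.of fun i => G (b i.succ) - G (b i.castSucc)).det :=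
  calc ∑ t ∈ interlacing b, (Matrix.of fun i => G (t i + 1) - G (t i)).det
    _ = (Matrix.of fun i => ∑ k ∈ Finset.Ico (b i.castSucc) (b i.succ), (G (k + 1) - G k)).det :=
      ((Matrix.detRowAlternating (n := Fin n) (R := A)).toMultilinearMap.map_sum_finset
        (fun _ k => G (k + 1) - G k) _).symm
    _ = _ := by simp_rw [fun i => Finset.sum_Ico_sub G (hb (Fin.castSucc_le_succ i))]

theorem det_sub_eq_det_cons_one (H : Fin (n + 1) → Fin n → A) :
    (Matrix.of fun i => H i.succ - H i.castSucc).det =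
      (Matrix.of fun i => (Fin.cons 1 (H i) : Fin (n + 1) → A)).det := by
  let B : Matrix (Fin (n + 1)) (Fin (n + 1)) A :=
    Matrix.of (Fin.cons (Fin.cons 1 (H 0)) fun i => Fin.cons 0 (H i.succ - H i.castSucc))
  have hB : (Matrix.of fun i => (Fin.cons 1 (H i) : Fin (n + 1) → A)).det = B.det := by
    refine Matrix.det_eq_of_forall_row_eq_smul_add_pred (fun _ => 1) (fun j => rfl) fun i j => ?_
    cases j using Fin.cases <;> simp [B]
  rw [hB, Matrix.det_succ_column_zero, Fin.sum_univ_succ]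
  simp only [B, Matrix.of_apply, Fin.cons_zero, Fin.cons_succ, mul_zero, zero_mul,
    Finset.sum_const_zero, add_zero, Fin.val_zero, pow_zero, one_mul]
  congr 1

theorem det_sub_eq_det_succ {H : Fin (n + 1) → Fin n → A} (h0 : H 0 = 0) :
    (Matrix.of fun i => H i.succ - H i.castSucc).det = (Matrix.of fun i => H i.succ).det := by
  rw [det_sub_eq_det_cons_one, Matrix.det_succ_row_zero, Fin.sum_univ_succ]
  simp [h0, Matrix.submatrix]

open Polynomial in
/-- The monic polynomials with the three-term recurrence `p 0 = 1`, `p 1 = X - a 0`,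
`p (j + 2) = (X - a (j + 1)) p (j + 1) - b j p j`. -/
noncomputable def threeTermPolynomial (a b : ℕ → A) : ℕ → A[X]
  | 0 => 1
  | 1 => X - C (a 0)
  | j + 2 => (X - C (a (j + 1))) * threeTermPolynomial a b (j + 1) -
      C (b j) * threeTermPolynomial a b j

theorem threeTermPolynomial_monic_natDegree [Nontrivial A] (a b : ℕ → A) (j : ℕ) :
    (threeTermPolynomial a b j).Monic ∧ (threeTermPolynomial a b j).natDegree = j := by
  induction j using Nat.twoStepInduction with
  | zero => simp [threeTermPolynomial]
  | one => simp [threeTermPolynomial, Polynomial.monic_X_sub_C]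
  | more j ih₀ ih₁ =>
    have hmonic := (Polynomial.monic_X_sub_C (a (j + 1))).mul ih₁.1
    have hdeg : ((Polynomial.X - Polynomial.C (a (j + 1))) *
        threeTermPolynomial a b (j + 1)).natDegree = j + 2 := by
      rw [(Polynomial.monic_X_sub_C _).natDegree_mul ih₁.1, Polynomial.natDegree_X_sub_C, ih₁.2]
      ring
    have hlt : (Polynomial.C (b j) * threeTermPolynomial a b j).natDegree < j + 2 :=
      (Polynomial.natDegree_C_mul_le _ _).trans_lt (by omega)
    refine ⟨hmonic.sub_of_left (Polynomial.degree_lt_degree (hdeg ▸ hlt)), ?_⟩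
    rw [threeTermPolynomial, Polynomial.natDegree_sub_eq_left_of_natDegree_lt (hdeg ▸ hlt), hdeg]

theorem det_of_threeTermRecurrence (a b : ℕ → A) (y : Fin n → A) (F : Fin n → ℕ → A)
    (h₁ : ∀ i, F i 1 = (y i - a 0) * F i 0)
    (h₂ : ∀ i j, F i (j + 2) = (y i - a (j + 1)) * F i (j + 1) - b j * F i j) :
    (Matrix.of fun i (j : Fin n) => F i j).det =
      (∏ i, F i 0) * (Matrix.vandermonde y).det := by
  nontriviality A
  have heval : ∀ i j, F i j = F i 0 * (threeTermPolynomial a b j).eval (y i) := fun i j => by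
    induction j using Nat.twoStepInduction with
    | zero => simp [threeTermPolynomial]
    | one => simp [threeTermPolynomial, h₁, mul_comm]
    | more j ih₀ ih₁ =>
      simp only [h₂, ih₀, ih₁, threeTermPolynomial, Polynomial.eval_sub, Polynomial.eval_mul,
        Polynomial.eval_X, Polynomial.eval_C]
      ring
  rw [Matrix.det_eval_matrixOfPolynomials_eq_det_vandermonde y (fun j => threeTermPolynomial a b j)
    (fun j => (threeTermPolynomial_monic_natDegree a b j).2)
    (fun j => (threeTermPolynomial_monic_natDegree a b j).1), ← Matrix.det_mul_column]
  congr 1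
  ext i j
  exact heval i j

end Determinant

section Hyperbolic

variable {K : Type*} [Field K]

/-- `2 cosh (k log q)`, the numerator of the weight of a vertical lozenge. -/
def qCosh (q : K) (k : ℤ) : K := q ^ k + q ^ (-k)

/-- `2 sinh (k log q)`, a symmetric version of the `q ^ 2`-integer `[k]`. -/
def qSinh (q : K) (k : ℤ) : K := q ^ k - q ^ (-k)

variable {q : K}

theorem qCosh_zero : qCosh q 0 = 2 := by
  simp [qCosh, one_add_one_eq_two]

theorem qSinh_zero : qSinh q 0 = 0 := by
  simp [qSinh]

theorem qCosh_neg (k : ℤ) : qCosh q (-k) = qCosh q k := by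
  simp [qCosh, add_comm]

theorem qSinh_neg (k : ℤ) : qSinh q (-k) = -qSinh q k := by
  simp [qSinh]

theorem qCosh_mul_qCosh (hq0 : q ≠ 0) (a b : ℤ) :
    qCosh q a * qCosh q b = qCosh q (b + a) + qCosh q (b - a) := by
  simp only [qCosh, sub_eq_add_neg, neg_add, neg_neg, zpow_add₀ hq0]
  ring

theorem qCosh_mul_qSinh (hq0 : q ≠ 0) (a b : ℤ) :
    qCosh q a * qSinh q b = qSinh q (b + a) + qSinh q (b - a) := by
  simp only [qCosh, qSinh, sub_eq_add_neg, neg_add, neg_neg, zpow_add₀ hq0]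
  ring

theorem qCosh_mul_qSinh_self (hq0 : q ≠ 0) (a : ℤ) :
    qCosh q a * qSinh q a = qSinh q (2 * a) := by
  rw [qCosh_mul_qSinh hq0, sub_self, qSinh_zero, add_zero, two_mul]

theorem qSinh_add_sub_qSinh_sub (hq0 : q ≠ 0) (a b : ℤ) :
    qSinh q (a + b) - qSinh q (a - b) = qCosh q a * qSinh q b := by
  simp only [qCosh, qSinh, sub_eq_add_neg, neg_add, neg_neg, zpow_add₀ hq0]
  ring

theorem qCosh_add_sub_qCosh_sub (hq0 : q ≠ 0) (a b : ℤ) :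
    qCosh q (a + b) - qCosh q (a - b) = qSinh q a * qSinh q b := by
  simp only [qCosh, qSinh, sub_eq_add_neg, neg_add, neg_neg, zpow_add₀ hq0]
  ring

theorem qSinh_eq_zpow_mul (hq0 : q ≠ 0) (k : ℤ) : qSinh q k = q ^ (-k) * (q ^ (2 * k) - 1) := by
  rw [mul_sub, ← zpow_add₀ hq0, qSinh]
  ring_nf

theorem pow_ne_one_of_not_isOfFinOrder (hq : ¬IsOfFinOrder q) {k : ℕ} (hk : k ≠ 0) : q ^ k ≠ 1 :=
  fun h => hq (isOfFinOrder_iff_pow_eq_one.2 ⟨k, Nat.pos_of_ne_zero hk, h⟩)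

theorem pow_add_one_ne_zero_of_not_isOfFinOrder (hq : ¬IsOfFinOrder q) {k : ℕ} (hk : k ≠ 0) :
    q ^ k + 1 ≠ 0 := fun h =>
  pow_ne_one_of_not_isOfFinOrder hq (mul_ne_zero hk two_ne_zero) <| by
    rw [pow_mul, eq_neg_of_add_eq_zero_left h, neg_one_sq]

theorem qSinh_ne_zero (hq0 : q ≠ 0) (hq : ¬IsOfFinOrder q) {k : ℕ} (hk : k ≠ 0) :
    qSinh q k ≠ 0 := by
  rw [qSinh_eq_zpow_mul hq0]
  refine mul_ne_zero (zpow_ne_zero _ hq0) (sub_ne_zero.2 ?_)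
  exact_mod_cast pow_ne_one_of_not_isOfFinOrder hq (k := 2 * k) (by omega)

theorem wt₂_vertical (h2 : (2 : K) ≠ 0) (a r : ℤ) :
    wt₂ q ((a, r), (a, r + 1)) = (if a = 0 then 1 / 2 else 1) * qCosh q a / 2 := by
  by_cases ha : a = 0
  · simp [wt₂, ha, qCosh_zero, h2]
  · simp [wt₂, ha, qCosh]

theorem wt₂_of_ne {L : UnitTriangle × UnitTriangle} (hL : L.1.1 ≠ L.2.1) : wt₂ q L = 1 :=
  if_neg hL

end Hyperbolic

section HyperbolicDeterminants

variable {K : Type*} [Field K] {q : K} {n : ℕ}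

theorem det_qSinh_odd_mul (hq0 : q ≠ 0) (u : Fin n → ℤ) :
    (Matrix.of fun i (j : Fin n) => qSinh q ((2 * j + 1) * u i)).det =
      (∏ i, qSinh q (u i)) * (Matrix.vandermonde fun i => qCosh q (2 * u i)).det := by
  convert det_of_threeTermRecurrence (Pi.single 0 (-1)) 1 (fun i => qCosh q (2 * u i))
    (fun i j => qSinh q ((2 * j + 1) * u i)) (fun i => ?_) fun i j => ?_ using 3
  · simp
  · rw [Pi.single_eq_same, sub_mul, qCosh_mul_qSinh hq0,
      show (2 * (0 : ℕ) + 1) * u i - 2 * u i = -u i by push_cast; ring, qSinh_neg]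
    push_cast
    ring_nf
  · rw [Pi.single_eq_of_ne (by omega), sub_zero, qCosh_mul_qSinh hq0, Pi.one_apply]
    push_cast
    ring_nf

theorem det_qCosh_odd_mul (hq0 : q ≠ 0) (u : Fin n → ℤ) :
    (Matrix.of fun i (j : Fin n) => qCosh q ((2 * j + 1) * u i)).det =
      (∏ i, qCosh q (u i)) * (Matrix.vandermonde fun i => qCosh q (2 * u i)).det := by
  convert det_of_threeTermRecurrence (Pi.single 0 1) 1 (fun i => qCosh q (2 * u i))
    (fun i j => qCosh q ((2 * j + 1) * u i)) (fun i => ?_) fun i j => ?_ using 3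
  · simp
  · rw [Pi.single_eq_same, sub_mul, qCosh_mul_qCosh hq0,
      show (2 * (0 : ℕ) + 1) * u i - 2 * u i = -u i by push_cast; ring, qCosh_neg]
    push_cast
    ring_nf
  · rw [Pi.single_eq_of_ne (by omega), sub_zero, qCosh_mul_qCosh hq0, Pi.one_apply]
    push_cast
    ring_nf

theorem det_qSinh_even_mul (hq0 : q ≠ 0) (u : Fin n → ℤ) :
    (Matrix.of fun i (j : Fin n) => qSinh q ((2 * (j + 1)) * u i)).det =
      (∏ i, qSinh q (2 * u i)) * (Matrix.vandermonde fun i => qCosh q (2 * u i)).det := by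
  convert det_of_threeTermRecurrence 0 1 (fun i => qCosh q (2 * u i))
    (fun i j => qSinh q ((2 * (j + 1)) * u i)) (fun i => ?_) fun i j => ?_ using 3
  · simp
  · rw [Pi.zero_apply, sub_zero, qCosh_mul_qSinh hq0,
      show (2 * ((0 : ℕ) + 1)) * u i - 2 * u i = 0 by push_cast; ring, qSinh_zero, add_zero]
    push_cast
    ring_nf
  · rw [Pi.zero_apply, sub_zero, qCosh_mul_qSinh hq0, Pi.one_apply]
    push_cast
    ring_nf

theorem det_cons_one_qCosh_mul (hq0 : q ≠ 0) (u : Fin (n + 1) → ℤ) :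
    (Matrix.of fun i => (Fin.cons 1 fun j : Fin n => qCosh q ((j + 1) * u i) :
      Fin (n + 1) → K)).det = (Matrix.vandermonde fun i => qCosh q (u i)).det := by
  convert det_of_threeTermRecurrence (F := fun i j => if j = 0 then 1 else qCosh q (j * u i)) 0
    (fun j => if j = 0 then 2 else 1) (fun i => qCosh q (u i)) (fun i => ?_) fun i j => ?_ using 2
  · ext i j
    cases j using Fin.cases <;> simp
  · simp
  · simp
  · rw [Pi.zero_apply, sub_zero, if_neg (by omega), if_neg (by omega), qCosh_mul_qCosh hq0]
    rcases j with _ | j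
    · simp [qCosh_zero, two_mul]
    · simp only [Nat.add_eq_zero_iff, one_ne_zero, and_false, if_false]
      push_cast
      ring_nf

end HyperbolicDeterminants

section StripSums

variable {K : Type*} [Field K] {q : K} {n : ℕ}

theorem sum_interlacing_even_strip (h2 : (2 : K) ≠ 0) (hq0 : q ≠ 0) (hq : ¬IsOfFinOrder q)
    (r : ℤ) {s : Fin n → ℕ} (hs : Monotone (Fin.cons 0 s : Fin (n + 1) → ℕ)) (hs₀ : ∀ i, s i ≠ 0) :
    ∑ t ∈ interlacing (Fin.cons 0 s), (∏ i, wt₂ q ((2 * t i, r), (2 * t i, r + 1))) *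
        (Matrix.vandermonde fun i => qCosh q (4 * t i)).det =
      (∏ j : Fin n, (2 * qSinh q (2 * j + 1))⁻¹) * ((∏ i, qSinh q (2 * s i - 1)) *
        (Matrix.vandermonde fun i => qCosh q (2 * (2 * s i - 1))).det) := by
  -- Putting `0` for the value at `c = 0` halves the first difference, since `qSinh` is odd: this is
  -- the weight `1 / 2` of the lozenges cut by the `j`-axis.
  let G : ℕ → Fin n → K := fun c j => (2 * qSinh q (2 * j + 1))⁻¹ *
    if c = 0 then 0 else qSinh q ((2 * j + 1) * (2 * c - 1))
  have hG : ∀ t : Fin n → ℕ, (∏ i, wt₂ q ((2 * t i, r), (2 * t i, r + 1))) *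
      (Matrix.vandermonde fun i => qCosh q (4 * t i)).det =
        (Matrix.of fun i => G (t i + 1) - G (t i)).det := fun t => by
    have hC := det_qCosh_odd_mul hq0 fun i => 2 * (t i : ℤ)
    simp only [← mul_assoc, show (2 * 2 : ℤ) = 4 by norm_num] at hC
    simp_rw [wt₂_vertical h2, mul_div_right_comm, Finset.prod_mul_distrib, mul_assoc]
    rw [← hC, ← Matrix.det_mul_column]
    congr 1
    ext i j
    have hS : qSinh q (2 * j + 1) ≠ 0 := mod_cast qSinh_ne_zero hq0 hq (Nat.succ_ne_zero (2 * j))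
    rcases Nat.eq_zero_or_pos (t i) with hti | hti
    · simp [G, hti, qCosh_zero, hS, h2, mul_right_comm _ (2⁻¹ : K)]
    · have hdiff := qSinh_add_sub_qSinh_sub hq0 ((2 * j + 1) * 2 * t i) (2 * j + 1)
      rw [show (2 * j + 1 : ℤ) * 2 * t i + (2 * j + 1) = (2 * j + 1) * (2 * (t i + 1 : ℕ) - 1) by
          push_cast; ring,
        show (2 * j + 1 : ℤ) * 2 * t i - (2 * j + 1) = (2 * j + 1) * (2 * t i - 1) by ring] at hdiff
      simp only [G, Matrix.of_apply, Pi.sub_apply, ← mul_sub, hti.ne', Nat.succ_ne_zero, if_false,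
        hdiff, mul_eq_zero, Nat.cast_eq_zero, two_ne_zero, or_self]
      field_simp
  have hdet := det_qSinh_odd_mul hq0 fun i => 2 * (s i : ℤ) - 1
  simp_rw [hG]
  rw [sum_interlacing_det_sub hs G,
    det_sub_eq_det_succ (H := fun i => G ((Fin.cons 0 s : Fin (n + 1) → ℕ) i)) (by ext; simp [G]),
    ← hdet, ← Matrix.det_mul_row]
  simp [G, hs₀]

theorem sum_interlacing_odd_strip (h2 : (2 : K) ≠ 0) (hq0 : q ≠ 0) (hq : ¬IsOfFinOrder q)
    (r : ℤ) {t : Fin (n + 1) → ℕ} (ht : Monotone t) :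
    ∑ c ∈ interlacing t, (∏ i, wt₂ q ((2 * c i + 1, r), (2 * c i + 1, r + 1))) *
        ((∏ i, qSinh q (2 * c i + 1)) *
          (Matrix.vandermonde fun i => qCosh q (2 * (2 * c i + 1))).det) =
      (∏ j : Fin n, (2 * qSinh q (2 * (j + 1)))⁻¹) *
        (Matrix.vandermonde fun i => qCosh q (4 * t i)).det := by
  let G : ℕ → Fin n → K := fun c j => (2 * qSinh q (2 * (j + 1)))⁻¹ * qCosh q ((j + 1) * (4 * c))
  have hG : ∀ c : Fin n → ℕ, (∏ i, wt₂ q ((2 * c i + 1, r), (2 * c i + 1, r + 1))) *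
      ((∏ i, qSinh q (2 * c i + 1)) *
        (Matrix.vandermonde fun i => qCosh q (2 * (2 * c i + 1))).det) =
        (Matrix.of fun i => G (c i + 1) - G (c i)).det := fun c => by
    have hodd : ∀ i, (2 * (c i : ℤ) + 1) ≠ 0 := fun i => by omega
    simp_rw [wt₂_vertical h2, if_neg (hodd _), one_mul, div_eq_inv_mul, Finset.prod_mul_distrib,
      mul_assoc]
    rw [← mul_assoc (∏ i, qCosh q _), ← Finset.prod_mul_distrib]
    simp_rw [qCosh_mul_qSinh_self hq0]
    rw [← det_qSinh_even_mul hq0, ← Matrix.det_mul_column]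
    congr 1
    ext i j
    have hS : qSinh q (2 * (j + 1)) ≠ 0 :=
      mod_cast qSinh_ne_zero hq0 hq (mul_ne_zero two_ne_zero (Nat.succ_ne_zero j))
    have hdiff := qCosh_add_sub_qCosh_sub hq0 (2 * (j + 1) * (2 * c i + 1)) (2 * (j + 1))
    rw [show (2 * (j + 1) * (2 * c i + 1) + 2 * (j + 1) : ℤ) = (j + 1) * (4 * (c i + 1 : ℕ)) by
        push_cast; ring,
      show (2 * (j + 1) * (2 * c i + 1) - 2 * (j + 1) : ℤ) = (j + 1) * (4 * c i) by ring] at hdiff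
    simp only [G, Matrix.of_apply, Pi.sub_apply, ← mul_sub, hdiff]
    field_simp
  have hdet := det_cons_one_qCosh_mul hq0 fun i => 4 * (t i : ℤ)
  simp_rw [hG]
  rw [sum_interlacing_det_sub ht G, det_sub_eq_det_cons_one (fun i => G (t i)), ← hdet]
  have hscale : ∏ j : Fin n, (2 * qSinh q (2 * (j + 1)))⁻¹ = ∏ j : Fin (n + 1),
      (Fin.cons 1 fun j : Fin n => (2 * qSinh q (2 * (j + 1)))⁻¹ : Fin (n + 1) → K) j := by
    simp [Fin.prod_univ_succ]
  rw [hscale, ← Matrix.det_mul_row]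
  congr 1
  ext i j
  cases j using Fin.cases <;> simp [G]

end StripSums

/-- The part of the strips between the heights `r` and `H` to the west of the lattice line
`i + j = W`, without the triangles of the lowest strip whose symmetry axes are at the abscissas
`d i`. The western border is the zigzag along the `j`-axis: the triangles with symmetry axis `i = 0`
belong to the region. -/
noncomputable def dentedTrapezoid {n : ℕ} (W H r : ℤ) (d : Fin n → ℤ) : Finset UnitTriangle :=
  ((Finset.Ico 0 (W - r) ×ˢ Finset.Ico r H).filter fun t => t.1 + t.2 < W) \
    Finset.univ.image fun i => (d i, r)

section DentedTrapezoid

variable {n N : ℕ} {W H r : ℤ}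

theorem mem_dentedTrapezoid {d : Fin n → ℤ} {t : UnitTriangle} :
    t ∈ dentedTrapezoid W H r d ↔
      (0 ≤ t.1 ∧ r ≤ t.2 ∧ t.2 < H ∧ t.1 + t.2 < W) ∧ (t.2 = r → ∀ i, t.1 ≠ d i) := by
  obtain ⟨a, j⟩ := t
  simp only [dentedTrapezoid, Finset.mem_sdiff, Finset.mem_filter, Finset.mem_product,
    Finset.mem_Ico, Finset.mem_image, Finset.mem_univ, true_and, Prod.mk.injEq, not_exists, not_and]
  constructor
  · rintro ⟨h, hd⟩
    exact ⟨by omega, fun hj i ha => hd i ha.symm hj.symm⟩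
  · rintro ⟨h, hd⟩
    exact ⟨by omega, fun i ha hj => hd hj.symm i ha.symm⟩

theorem dentedTrapezoid_upper_sdiff {m : ℕ} (d : Fin n → ℤ) (d' : Fin m → ℤ) :
    (dentedTrapezoid W H r d).filter (r < ·.2) \
        Finset.univ.image (fun i => ((d' i, r + 1) : UnitTriangle)) =
      dentedTrapezoid W H (r + 1) d' := by
  ext ⟨a, j⟩
  simp only [Finset.mem_sdiff, Finset.mem_filter, mem_dentedTrapezoid, Finset.mem_image,
    Finset.mem_univ, true_and, Prod.mk.injEq, not_exists, not_and]
  constructor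
  · rintro ⟨⟨⟨h, -⟩, hj⟩, hd⟩
    exact ⟨by omega, fun hj i ha => hd i ha.symm hj.symm⟩
  · rintro ⟨h, hd⟩
    exact ⟨⟨⟨by omega, fun hj => by omega⟩, by omega⟩, fun i ha hj => hd hj.symm i ha.symm⟩

variable {K : Type*} [Field K] {wt : UnitTriangle × UnitTriangle → K}

/-- The western border acts as one more dent, at position `0`. -/
theorem tilingGF_dentedTrapezoid_of_even (hwt : ∀ L, L.1.1 ≠ L.2.1 → wt L = 1) (hr : Even r)
    (hW : W = 2 * N + r) (hH : r + n < H) {s : Fin n → ℕ}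
    (hs : StrictMono (Fin.cons 0 s : Fin (n + 1) → ℕ)) (hsN : ∀ i, s i ≤ N) :
    tilingGF (dentedTrapezoid W H r fun i => 2 * (s i : ℤ) - 1) wt =
      ∑ t ∈ interlacing (Fin.cons 0 s), (∏ i, wt ((2 * t i, r), (2 * t i, r + 1))) *
        tilingGF (dentedTrapezoid W H (r + 1) fun i => 2 * (t i : ℤ)) wt := by
  set R := dentedTrapezoid W H r fun i => 2 * (s i : ℤ) - 1
  have hbN : ∀ i, (Fin.cons 0 s : Fin (n + 1) → ℕ) i ≤ N :=
    Fin.forall_fin_succ.2 ⟨Nat.zero_le N, hsN⟩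
  have hlast : (Fin.cons 0 s : Fin (n + 1) → ℕ) (Fin.last n) ≠ 0 → n ≠ 0 := by
    rintro h rfl
    exact h rfl
  have hstrip := tilingGF_trimStrip_eq_sum_interlacing (R := R) (e := 0) hwt
    (fun t ht => (mem_dentedTrapezoid.1 ht).1.2.1) (by simpa using hr) hs (hbN _)
    (fun a ha => by
      simp only [Fin.cons_zero, Fin.cons_succ, R, mem_dentedTrapezoid] at ha ⊢
      grind)
    (fun j hj => by
      have := hbN (Fin.last n)
      rw [Finset.mem_Ico] at hj
      exact mem_dentedTrapezoid.2 ⟨by grind, fun h => by omega⟩)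
  simpa only [add_zero, Fin.cons_zero, Nat.cast_zero, mul_zero, R, dentedTrapezoid_upper_sdiff,
    trimStrip_eq_self fun _ ht _ => (mem_dentedTrapezoid.1 ht).1.1] using hstrip

theorem tilingGF_dentedTrapezoid_of_odd (hwt : ∀ L, L.1.1 ≠ L.2.1 → wt L = 1) (hr : Odd r)
    (hW : W = 2 * N + 1 + r) (hH : r + n < H) {t : Fin (n + 1) → ℕ} (ht : StrictMono t)
    (htN : ∀ i, t i ≤ N) :
    tilingGF (dentedTrapezoid W H r fun i => 2 * (t i : ℤ)) wt =
      ∑ c ∈ interlacing t, (∏ i, wt ((2 * c i + 1, r), (2 * c i + 1, r + 1))) *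
        tilingGF (dentedTrapezoid W H (r + 1) fun i => 2 * (c i : ℤ) + 1) wt := by
  set R := dentedTrapezoid W H r fun i => 2 * (t i : ℤ)
  have hR : ∀ u ∈ R, r ≤ u.2 := fun u hu => (mem_dentedTrapezoid.1 hu).1.2.1
  have ht0 : ∀ i, t 0 ≤ t i := fun i => ht.monotone (Fin.zero_le i)
  have hchain : tilingGF R wt = tilingGF (trimStrip R r (2 * t 0 + 1)) wt := by
    have h := tilingGF_trimStrip_add_two_mul (a := 0) hwt hR (by simpa using hr) (t 0)
      fun b hb0 hb => mem_dentedTrapezoid.2 ⟨by grind, fun _ i => by have := ht0 i; grind⟩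
    rwa [zero_add, trimStrip_eq_self fun u hu _ => (mem_dentedTrapezoid.1 hu).1.1,
      ← trimStrip_add_one fun hmem => (mem_dentedTrapezoid.1 hmem).2 rfl 0 rfl] at h
  have hlast : t (Fin.last n) ≠ t 0 → n ≠ 0 := by
    rintro h rfl
    exact h rfl
  have hstrip := tilingGF_trimStrip_eq_sum_interlacing (R := R) (e := 1) hwt hR
    (by simpa [add_comm] using hr.add_one) ht (htN _)
    (fun a ha => by
      simp only [R, mem_dentedTrapezoid, Fin.forall_fin_succ]
      grind)
    (fun j hj => by
      have := htN (Fin.last n)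
      rw [Finset.mem_Ico] at hj
      exact mem_dentedTrapezoid.2 ⟨by grind, fun h => by omega⟩)
  simpa only [hchain, R, dentedTrapezoid_upper_sdiff] using hstrip

end DentedTrapezoid

theorem prod_Icc_one_two_mul_add_one {M : Type*} [CommMonoid M] (f : ℕ → M) (n : ℕ) :
    ∏ k ∈ Finset.Icc 1 (2 * n + 1), f k =
      (∏ j : Fin (n + 1), f (2 * j + 1)) * ∏ j : Fin n, f (2 * (j + 1)) := by
  rw [Fin.prod_univ_eq_prod_range (fun j => f (2 * j + 1)),
    Fin.prod_univ_eq_prod_range fun j => f (2 * (j + 1))]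
  induction n with
  | zero => simp
  | succ n ih =>
    rw [Finset.prod_range_succ, Finset.prod_range_succ (fun j => f (2 * (j + 1))),
      mul_mul_mul_comm, ← ih, mul_comm (f _), ← mul_assoc, mul_add_one,
      Finset.prod_Icc_succ_top (by omega), Finset.prod_Icc_succ_top (by omega)]

section Evaluation

variable {K : Type*} [Field K] {q C : K} {n N : ℕ} {W H r : ℤ}

theorem tilingGF_wt₂_dentedTrapezoid_of_odd (h2 : (2 : K) ≠ 0) (hq0 : q ≠ 0)
    (hq : ¬IsOfFinOrder q) (hr : Odd r) (hW : W = 2 * N + 1 + r) (hH : r + n < H)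
    (h : ∀ c : Fin n → ℕ, StrictMono c → (∀ i, c i < N) →
      tilingGF (dentedTrapezoid W H (r + 1) fun i => 2 * (c i : ℤ) + 1) (wt₂ q) =
        C * ((∏ i, qSinh q (2 * c i + 1)) *
          (Matrix.vandermonde fun i => qCosh q (2 * (2 * c i + 1))).det))
    {t : Fin (n + 1) → ℕ} (ht : StrictMono t) (htN : ∀ i, t i ≤ N) :
    tilingGF (dentedTrapezoid W H r fun i => 2 * (t i : ℤ)) (wt₂ q) =
      C * ((∏ j : Fin n, (2 * qSinh q (2 * (j + 1)))⁻¹) *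
        (Matrix.vandermonde fun i => qCosh q (4 * t i)).det) := by
  rw [tilingGF_dentedTrapezoid_of_odd (fun _ => wt₂_of_ne) hr hW hH ht htN,
    ← sum_interlacing_odd_strip h2 hq0 hq r ht.monotone, Finset.mul_sum]
  refine Finset.sum_congr rfl fun c hc => ?_
  rw [h c (strictMono_of_mem_interlacing ht.monotone hc)
    fun i => (mem_interlacing.1 hc i).2.trans_le (htN _), mul_left_comm]

theorem tilingGF_wt₂_dentedTrapezoid_of_even (h2 : (2 : K) ≠ 0) (hq0 : q ≠ 0)
    (hq : ¬IsOfFinOrder q) (hr : Even r) (hW : W = 2 * N + r) (hH : r + n < H)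
    (h : ∀ t : Fin n → ℕ, StrictMono t → (∀ i, t i < N) →
      tilingGF (dentedTrapezoid W H (r + 1) fun i => 2 * (t i : ℤ)) (wt₂ q) =
        C * (Matrix.vandermonde fun i => qCosh q (4 * t i)).det)
    {s : Fin n → ℕ} (hs : StrictMono (Fin.cons 0 s : Fin (n + 1) → ℕ)) (hsN : ∀ i, s i ≤ N) :
    tilingGF (dentedTrapezoid W H r fun i => 2 * (s i : ℤ) - 1) (wt₂ q) =
      C * ((∏ j : Fin n, (2 * qSinh q (2 * j + 1))⁻¹) * ((∏ i, qSinh q (2 * s i - 1)) *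
        (Matrix.vandermonde fun i => qCosh q (2 * (2 * s i - 1))).det)) := by
  have hs₀ : ∀ i, s i ≠ 0 := fun i => (hs (Fin.succ_pos i)).ne'
  rw [tilingGF_dentedTrapezoid_of_even (fun _ => wt₂_of_ne) hr hW hH hs hsN,
    ← sum_interlacing_even_strip h2 hq0 hq r hs.monotone hs₀, Finset.mul_sum]
  refine Finset.sum_congr rfl fun t ht => ?_
  rw [h t (strictMono_of_mem_interlacing hs.monotone ht)
    fun i => (mem_interlacing.1 ht i).2.trans_le (hsN _), mul_left_comm]

theorem tilingGF_wt₂_dentedTrapezoid (h2 : (2 : K) ≠ 0) (hq0 : q ≠ 0) (hq : ¬IsOfFinOrder q)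
    (x : ℕ) (hr : Even r) {s : Fin n → ℕ} (hs : StrictMono s) (hs₀ : ∀ i, 0 < s i)
    (hsN : ∀ i, s i ≤ x + n) :
    tilingGF (dentedTrapezoid (2 * (x + n) + r) (2 * n + r) r fun i => 2 * (s i : ℤ) - 1) (wt₂ q) =
      (∏ i ∈ Finset.Icc 1 n, ∏ k ∈ Finset.Icc 1 (2 * i - 1), (2 * qSinh q k)⁻¹) *
        ((∏ i, qSinh q (2 * s i - 1)) *
          (Matrix.vandermonde fun i => qCosh q (2 * (2 * s i - 1))).det) := by
  induction n generalizing r with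
  | zero =>
    have hempty : dentedTrapezoid (2 * (x + (0 : ℕ)) + r) (2 * (0 : ℕ) + r) r
        (fun i => 2 * (s i : ℤ) - 1) = ∅ :=
      Finset.eq_empty_of_forall_notMem fun t ht => by
        have := (mem_dentedTrapezoid.1 ht).1
        omega
    rw [hempty, tilingGF_empty]
    simp
  | succ n ih =>
    have hstrip := tilingGF_wt₂_dentedTrapezoid_of_even (W := 2 * (x + (n + 1 : ℕ)) + r)
      (H := 2 * (n + 1 : ℕ) + r) (N := x + (n + 1)) h2 hq0 hq hr (by push_cast; ring)
      (by push_cast; omega)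
      (fun t ht htN => by
        rw [tilingGF_wt₂_dentedTrapezoid_of_odd (N := x + n) h2 hq0 hq hr.add_one
          (by push_cast; ring) (by push_cast; omega) (fun c hc hcN => ?_) ht
          fun i => Nat.lt_succ_iff.1 (htN i), ← mul_assoc]
        have hih := ih (r := r + 2) (by grind) (s := fun i => c i + 1)
          (fun i j hij => Nat.succ_lt_succ (hc hij)) (fun i => Nat.succ_pos _) hcN
        have hdent : ∀ i, 2 * ((c i + 1 : ℕ) : ℤ) - 1 = 2 * c i + 1 := fun i => by
          push_cast
          ring
        simp only [hdent] at hih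
        convert hih using 3 <;> push_cast <;> ring)
      (strictMono_vecCons.2 ⟨hs₀ 0, hs⟩) hsN
    rw [hstrip, Finset.prod_Icc_succ_top (by omega), show 2 * (n + 1) - 1 = 2 * n + 1 by omega,
      prod_Icc_one_two_mul_add_one fun k => (2 * qSinh q k)⁻¹]
    push_cast
    ring

theorem mem_trapezoid {x n : ℕ} {t : UnitTriangle} :
    t ∈ trapezoid x n ↔ 0 ≤ t.1 ∧ 0 ≤ t.2 ∧ t.2 < 2 * n ∧ t.1 + t.2 < 2 * (x + n) := by
  obtain ⟨a, r⟩ := t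
  rw [trapezoid, Finset.mem_filter, Finset.mem_product, Finset.mem_Icc, Finset.mem_Ico]
  have hup : UnitTriangle.IsUp (a, r) ↔ (Odd a ↔ Even r) := Int.odd_add
  simp only [UnitTriangle.vertices, hup, westEnd, eastEnd]
  split_ifs with h <;>
    simp only [Finset.forall_mem_insert, Finset.mem_singleton, forall_eq] <;> grind

theorem quarteredHexagon_eq_dentedTrapezoid (x n : ℕ) (s : ℕ → ℕ) :
    quarteredHexagon x n s =
      dentedTrapezoid (2 * (x + n)) (2 * n) 0 fun i : Fin n => 2 * (s (i + 1) : ℤ) - 1 := by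
  ext ⟨a, r⟩
  simp only [quarteredHexagon, Finset.mem_sdiff, mem_trapezoid, mem_dentedTrapezoid,
    Finset.mem_image, Finset.mem_Icc, baseTriangle, Prod.mk.injEq, not_exists, not_and, and_imp]
  refine and_congr_right fun _ => ⟨fun h hr i ha => ?_, fun h i hi hin ha hr => ?_⟩
  · exact h (i + 1) (by omega) (by omega) ha.symm hr.symm
  · exact h hr.symm ⟨i - 1, by omega⟩ (by rw [Nat.sub_add_cancel hi, ha])

end Evaluation

section Products

variable {M : Type*} [CommMonoid M]

theorem prod_fin_add_one (n : ℕ) (f : ℕ → M) :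
    ∏ i : Fin n, f (i + 1) = ∏ i ∈ Finset.Icc 1 n, f i := by
  rw [Fin.prod_univ_eq_prod_range (fun i => f (i + 1)), Finset.range_eq_Ico,
    Finset.prod_Ico_add' f]
  rfl

theorem prod_Icc_Ioc_comm (n : ℕ) (f : ℕ → ℕ → M) :
    ∏ i ∈ Finset.Icc 1 n, ∏ j ∈ Finset.Ioc i n, f i j =
      ∏ j ∈ Finset.Icc 1 n, ∏ i ∈ Finset.Ico 1 j, f i j :=
  Finset.prod_comm' fun i j => by simp only [Finset.mem_Icc, Finset.mem_Ioc, Finset.mem_Ico]; omega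

theorem prod_Icc_Icc_comm (n : ℕ) (f : ℕ → ℕ → M) :
    ∏ i ∈ Finset.Icc 1 n, ∏ j ∈ Finset.Icc i n, f i j =
      ∏ j ∈ Finset.Icc 1 n, ∏ i ∈ Finset.Icc 1 j, f i j :=
  Finset.prod_comm' fun i j => by simp only [Finset.mem_Icc]; omega

theorem prod_fin_Ioi_add_one (n : ℕ) (f : ℕ → ℕ → M) :
    ∏ i : Fin n, ∏ j ∈ Finset.Ioi i, f (i + 1) (j + 1) =
      ∏ j ∈ Finset.Icc 1 n, ∏ i ∈ Finset.Ico 1 j, f i j := by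
  rw [Finset.prod_comm' (t' := Finset.univ) (s' := Finset.Iio) (by simp),
    ← prod_fin_add_one n fun j => ∏ i ∈ Finset.Ico 1 j, f i j]
  refine Finset.prod_congr rfl fun j _ => ?_
  rw [← Finset.prod_Ico_add' (f · (j + 1)) 0 j 1, ← Nat.bot_eq_zero, Finset.Ico_bot,
    ← Fin.map_valEmbedding_Iio, Finset.prod_map]
  rfl

end Products

section ProductFormula

variable {K : Type*} [Field K] {q : K}

theorem det_vandermonde_qCosh (hq0 : q ≠ 0) (n : ℕ) (s : ℕ → ℕ) :
    (Matrix.vandermonde fun i : Fin n => qCosh q (2 * (2 * s (i + 1) - 1))).det =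
      ∏ j ∈ Finset.Icc 1 n, ∏ i ∈ Finset.Ico 1 j,
        (qSinh q (2 * (s i + s j - 1)) * qSinh q (2 * (s j - s i))) := by
  rw [← prod_fin_Ioi_add_one n fun i j =>
    qSinh q (2 * (s i + s j - 1)) * qSinh q (2 * (s j - s i)), Matrix.det_vandermonde]
  refine Finset.prod_congr rfl fun i _ => Finset.prod_congr rfl fun j _ => ?_
  rw [← qCosh_add_sub_qCosh_sub hq0]
  ring_nf

theorem tilingGF_quarteredHexagon (h2 : (2 : K) ≠ 0) (hq0 : q ≠ 0) (hq : ¬IsOfFinOrder q)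
    {x n : ℕ} {s : ℕ → ℕ} (hs : ∀ i ∈ Set.Icc 1 n, 1 ≤ s i ∧ s i ≤ n + x)
    (hmono : StrictMonoOn s (Set.Icc 1 n)) :
    tilingGF (quarteredHexagon x n s) (wt₂ q) =
      ∏ j ∈ Finset.Icc 1 n, (∏ k ∈ Finset.Icc 1 (2 * j - 1), (2 * qSinh q k)⁻¹) *
        (qSinh q (2 * s j - 1) * ∏ i ∈ Finset.Ico 1 j,
          (qSinh q (2 * (s i + s j - 1)) * qSinh q (2 * (s j - s i)))) := by
  have hmem : ∀ i : Fin n, (i : ℕ) + 1 ∈ Set.Icc 1 n := fun i => ⟨by omega, i.2⟩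
  have h := tilingGF_wt₂_dentedTrapezoid h2 hq0 hq x Even.zero (s := fun i : Fin n => s (i + 1))
    (fun i j hij => hmono (hmem i) (hmem j) (Nat.succ_lt_succ hij)) (fun i => (hs _ (hmem i)).1)
    fun i => (hs _ (hmem i)).2.trans_eq (add_comm n x)
  rw [det_vandermonde_qCosh hq0, prod_fin_add_one n fun i => qSinh q (2 * s i - 1), add_zero,
    add_zero] at h
  rw [quarteredHexagon_eq_dentedTrapezoid, h, Finset.prod_mul_distrib, Finset.prod_mul_distrib]

end ProductFormula

section QIntegers

variable {K : Type*} [Field K] {q : K}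

theorem qInt_sq (hq0 : q ≠ 0) (h1 : qSinh q 1 ≠ 0) (m : ℕ) :
    qInt (q ^ 2) m = q ^ (m - 1 : ℤ) * qSinh q m / qSinh q 1 := by
  have hgeom : qInt (q ^ 2) m * (q * qSinh q 1) = q ^ (m : ℤ) * qSinh q m := by
    have hcancel : ∀ k : ℤ, q ^ k * qSinh q k = q ^ (2 * k) - 1 := fun k => by
      rw [qSinh_eq_zpow_mul hq0, ← mul_assoc, ← zpow_add₀ hq0, add_neg_cancel, zpow_zero, one_mul]
    have h := geom_sum_mul (q ^ 2) m
    have hone := hcancel 1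
    rw [zpow_one] at hone
    rw [hone, hcancel, qInt]
    exact_mod_cast h.trans (by rw [pow_mul])
  rw [eq_div_iff h1, zpow_sub_one₀ hq0]
  field_simp
  linear_combination hgeom

theorem qFactorial_sq_mul (hq0 : q ≠ 0) (h1 : qSinh q 1 ≠ 0) (m : ℕ) :
    qFactorial (q ^ 2) m * qSinh q 1 ^ m =
      q ^ m.choose 2 * ∏ k ∈ Finset.Icc 1 m, qSinh q k := by
  induction m with
  | zero => simp [qFactorial]
  | succ m ih =>
    rw [qFactorial] at ih ⊢
    rw [Finset.prod_Icc_succ_top (by omega), Finset.prod_Icc_succ_top (by omega),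
      pow_succ (qSinh q 1), mul_mul_mul_comm, ih, qInt_sq hq0 h1, div_mul_cancel₀ _ h1,
      Nat.choose_succ_succ' m 1, Nat.choose_one_right, pow_add, Nat.cast_succ,
      add_sub_cancel_right, zpow_natCast]
    ring

theorem qInt_two_mul (p : K) (m : ℕ) : qInt p (2 * m) = qInt p m * (p ^ m + 1) := by
  rw [qInt, qInt, two_mul, Finset.sum_range_add, mul_add_one, add_comm, Finset.sum_mul]
  simp only [pow_add, mul_comm]

theorem qFactorial_two_mul_sub_one (p : K) {j : ℕ} (hj : 1 ≤ j) :
    qFactorial p (2 * j - 1) =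
      (∏ i ∈ Finset.Icc 1 j, qInt p (i + j - 1)) * ∏ i ∈ Finset.Ico 1 j, qInt p (j - i) := by
  have hIcc : ∏ i ∈ Finset.Icc 1 j, qInt p (i + j - 1) = ∏ k ∈ Finset.Ico j (2 * j), qInt p k := by
    have h := Finset.prod_Ico_add' (qInt p) 1 (j + 1) (j - 1)
    rw [show 1 + (j - 1) = j by omega, show j + 1 + (j - 1) = 2 * j by omega] at h
    exact h ▸ Finset.prod_congr rfl fun i _ => by rw [Nat.add_sub_assoc hj]
  have hIco := Finset.prod_Ico_reflect (qInt p) 1 (Nat.le_succ j)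
  rw [Nat.add_sub_cancel_left, Nat.add_sub_cancel] at hIco
  have hall : Finset.Icc 1 (2 * j - 1) = Finset.Ico 1 (2 * j) := by
    ext
    simp only [Finset.mem_Icc, Finset.mem_Ico]
    omega
  rw [hIcc, hIco, mul_comm (∏ k ∈ Finset.Ico j _, _), qFactorial, hall,
    Finset.prod_Ico_consecutive _ hj (by omega)]

theorem prod_zpow_eq_zpow_sum (hq0 : q ≠ 0) {ι : Type*} (t : Finset ι) (f : ι → ℤ) :
    ∏ i ∈ t, q ^ f i = q ^ ∑ i ∈ t, f i := by
  classical
  induction t using Finset.induction_on with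
  | empty => simp
  | insert i t hi ih => rw [Finset.prod_insert hi, Finset.sum_insert hi, ih, zpow_add₀ hq0]

theorem sum_Icc_one_sub_two_mul (n : ℕ) :
    ∑ j ∈ Finset.Icc 1 n, (1 - 2 * j : ℤ) = -(n ^ 2 : ℤ) := by
  induction n with
  | zero => simp
  | succ n ih =>
    rw [Finset.sum_Icc_succ_top (by omega), ih]
    push_cast
    ring

theorem qInt_factor_mul_qSinh_one_pow (hq0 : q ≠ 0) (h1 : qSinh q 1 ≠ 0) {j : ℕ} (hj : 1 ≤ j)
    {s : ℕ → ℕ} (hsj : 1 ≤ s j) (hsle : ∀ i ∈ Finset.Ico 1 j, s i ≤ s j) :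
    qInt (q ^ 2) (2 * s j - 1) * (∏ i ∈ Finset.Ico 1 j,
        (qInt (q ^ 2) (2 * (s i + s j - 1)) * qInt (q ^ 2) (2 * (s j - s i)))) *
      qSinh q 1 ^ (2 * j - 1) =
      q ^ ((2 * j - 1) * (2 * s j - 2) : ℤ) * (qSinh q (2 * s j - 1) * ∏ i ∈ Finset.Ico 1 j,
        (qSinh q (2 * (s i + s j - 1)) * qSinh q (2 * (s j - s i)))) := by
  have hpair : ∀ i ∈ Finset.Ico 1 j,
      qInt (q ^ 2) (2 * (s i + s j - 1)) * qInt (q ^ 2) (2 * (s j - s i)) =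
        q ^ (4 * s j - 4 : ℤ) / qSinh q 1 ^ 2 *
          (qSinh q (2 * (s i + s j - 1)) * qSinh q (2 * (s j - s i))) := fun i hi => by
    have hle := hsle i hi
    rw [qInt_sq hq0 h1, qInt_sq hq0 h1, show (4 * s j - 4 : ℤ) =
      ((2 * (s i + s j - 1) : ℕ) - 1 : ℤ) + ((2 * (s j - s i) : ℕ) - 1 : ℤ) by omega,
      zpow_add₀ hq0]
    push_cast [hle, show 1 ≤ s i + s j by omega]
    ring
  rw [Finset.prod_congr rfl hpair, Finset.prod_mul_distrib, Finset.prod_const, Nat.card_Ico,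
    qInt_sq hq0 h1, show 2 * j - 1 = 2 * (j - 1) + 1 by omega, show
      ((2 * j - 1) * (2 * s j - 2) : ℤ) = (2 * s j - 2) + (4 * s j - 4) * (j - 1 : ℕ) by
        push_cast [hj]; ring, zpow_add₀ hq0, zpow_mul, zpow_natCast, div_pow, ← pow_mul, pow_succ,
    show ((2 * s j - 1 : ℕ) : ℤ) = 2 * s j - 1 by omega,
    show (2 * s j - 1 - 1 : ℤ) = 2 * s j - 2 by ring]
  field_simp

theorem qSinh_factor_eq_qInt_factor (h2 : (2 : K) ≠ 0) (hq0 : q ≠ 0) (hq : ¬IsOfFinOrder q)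
    {j : ℕ} (hj : 1 ≤ j) {s : ℕ → ℕ} (hsj : 1 ≤ s j) (hsle : ∀ i ∈ Finset.Ico 1 j, s i ≤ s j) :
    (∏ k ∈ Finset.Icc 1 (2 * j - 1), (2 * qSinh q k)⁻¹) *
        (qSinh q (2 * s j - 1) * ∏ i ∈ Finset.Ico 1 j,
          (qSinh q (2 * (s i + s j - 1)) * qSinh q (2 * (s j - s i)))) =
      2 ^ (1 - 2 * j : ℤ) * q ^ (-((4 * j - 2) * s j - 2 * j ^ 2 - j + 1) : ℤ) *
        (qInt (q ^ 2) (2 * s j - 1) * (∏ i ∈ Finset.Ico 1 j,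
          (qInt (q ^ 2) (2 * (s i + s j - 1)) * qInt (q ^ 2) (2 * (s j - s i)))) /
            qFactorial (q ^ 2) (2 * j - 1)) := by
  have h1 : qSinh q 1 ≠ 0 := mod_cast qSinh_ne_zero hq0 hq one_ne_zero
  have hP : ∏ k ∈ Finset.Icc 1 (2 * j - 1), qSinh q k ≠ 0 := Finset.prod_ne_zero_iff.2
    fun k hk => qSinh_ne_zero hq0 hq (Nat.one_le_iff_ne_zero.1 (Finset.mem_Icc.1 hk).1)
  have hfact := qFactorial_sq_mul hq0 h1 (2 * j - 1)
  have hexp : ((2 * j - 1) * (2 * s j - 2) : ℤ) =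
      ((4 * j - 2) * s j - 2 * j ^ 2 - j + 1) + ((2 * j - 1).choose 2 : ℕ) := by
    obtain ⟨m, rfl⟩ := Nat.exists_eq_add_of_le' hj
    rw [show 2 * (m + 1) - 1 = 2 * m + 1 by omega, Nat.choose_two_right, Nat.add_sub_cancel,
      mul_left_comm, Nat.mul_div_cancel_left _ two_pos]
    push_cast
    ring
  have htwo : (2 : K) ^ (1 - 2 * j : ℤ) = (2 ^ (2 * j - 1))⁻¹ := by
    rw [← zpow_natCast, ← zpow_neg]
    congr 1
    omega
  rw [eq_div_of_mul_eq (pow_ne_zero _ h1) (qInt_factor_mul_qSinh_one_pow hq0 h1 hj hsj hsle),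
    eq_div_of_mul_eq (pow_ne_zero _ h1) hfact, hexp, zpow_add₀ hq0, zpow_natCast, zpow_neg, htwo]
  simp only [mul_inv, Finset.prod_mul_distrib, Finset.prod_inv_distrib, Finset.prod_const,
    Nat.card_Icc, Nat.add_sub_cancel]
  field_simp

theorem qInt_factor_eq (p : K) {j : ℕ} (hj : 1 ≤ j) {s : ℕ → ℕ} (hsj : 1 ≤ s j)
    (hp : p ^ (2 * s j - 1) + 1 ≠ 0) :
    qInt p (2 * s j - 1) * (∏ i ∈ Finset.Ico 1 j,
        (qInt p (2 * (s i + s j - 1)) * qInt p (2 * (s j - s i)))) / qFactorial p (2 * j - 1) =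
      1 / (p ^ (2 * s j - 1) + 1) *
        (∏ i ∈ Finset.Icc 1 j, qInt p (2 * (s i + s j - 1)) / qInt p (i + j - 1)) *
        ∏ i ∈ Finset.Ico 1 j, qInt p (2 * (s j - s i)) / qInt p (j - i) := by
  rw [qFactorial_two_mul_sub_one p hj, Finset.prod_div_distrib, Finset.prod_div_distrib,
    Finset.prod_mul_distrib,
    ← Finset.prod_Ico_mul_eq_prod_Icc hj (f := fun i => qInt p (2 * (s i + s j - 1))),
    show s j + s j - 1 = 2 * s j - 1 by omega, qInt_two_mul]
  field_simp

end QIntegers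

theorem not_isOfFinOrder_ratFunc_X {F : Type*} [Field F] :
    ¬IsOfFinOrder (RatFunc.X : RatFunc F) := by
  rw [isOfFinOrder_iff_pow_eq_one]
  rintro ⟨m, hm, h⟩
  exact RatFunc.transcendental_X (.of_pow hm (h ▸ isAlgebraic_one))

theorem mainTheorem6_general {K : Type*} [Field K] (h2 : (2 : K) ≠ 0) (x n : ℕ) (s : ℕ → ℕ)
    (hs : ∀ i ∈ Set.Icc 1 n, 1 ≤ s i ∧ s i ≤ n + x)
    (hmono : StrictMonoOn s (Set.Icc 1 n))
    (q : K) (hq0 : q ≠ 0) (hq : ¬IsOfFinOrder q) :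
    tilingGF (quarteredHexagon x n s) (wt₂ q) =
        (2 : K) ^ (-(n ^ 2 : ℤ)) *
        q ^ (-∑ i ∈ Finset.Icc 1 n, ((4 * i - 2) * s i - 2 * i ^ 2 - i + 1 : ℤ)) *
        (((∏ i ∈ Finset.Icc 1 n, qInt (q ^ 2) (2 * s i - 1)) *
          ∏ i ∈ Finset.Icc 1 n, ∏ j ∈ Finset.Ioc i n,
            (qInt (q ^ 2) (2 * (s i + s j - 1)) * qInt (q ^ 2) (2 * (s j - s i)))) /
          ∏ i ∈ Finset.Icc 1 n, qFactorial (q ^ 2) (2 * i - 1)) ∧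
    tilingGF (quarteredHexagon x n s) (wt₂ q) =
        (2 : K) ^ (-(n ^ 2 : ℤ)) *
        q ^ (-∑ i ∈ Finset.Icc 1 n, ((4 * i - 2) * s i - 2 * i ^ 2 - i + 1 : ℤ)) *
        (∏ i ∈ Finset.Icc 1 n, 1 / (q ^ (4 * s i - 2) + 1)) *
        (∏ i ∈ Finset.Icc 1 n, ∏ j ∈ Finset.Icc i n,
          qInt (q ^ 2) (2 * (s i + s j - 1)) / qInt (q ^ 2) (i + j - 1)) *
        ∏ i ∈ Finset.Icc 1 n, ∏ j ∈ Finset.Ioc i n,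
          qInt (q ^ 2) (2 * (s j - s i)) / qInt (q ^ 2) (j - i) := by
  have hpos : ∀ j ∈ Finset.Icc 1 n, 1 ≤ j ∧ 1 ≤ s j := fun j hj =>
    ⟨(Finset.mem_Icc.1 hj).1, (hs j (Finset.mem_Icc.1 hj)).1⟩
  have hsle : ∀ j ∈ Finset.Icc 1 n, ∀ i ∈ Finset.Ico 1 j, s i ≤ s j := fun j hj i hi => by
    rw [Finset.mem_Icc] at hj
    rw [Finset.mem_Ico] at hi
    exact (hmono ⟨hi.1, hi.2.le.trans hj.2⟩ hj hi.2).le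
  have hform := tilingGF_quarteredHexagon h2 hq0 hq hs hmono
  rw [Finset.prod_congr rfl fun j hj => qSinh_factor_eq_qInt_factor h2 hq0 hq (hpos j hj).1
      (hpos j hj).2 (hsle j hj), Finset.prod_mul_distrib, Finset.prod_mul_distrib,
    prod_zpow_eq_zpow_sum h2, prod_zpow_eq_zpow_sum hq0, sum_Icc_one_sub_two_mul,
    Finset.sum_neg_distrib] at hform
  refine ⟨?_, ?_⟩
  · rw [hform, prod_Icc_Ioc_comm, ← Finset.prod_mul_distrib, ← Finset.prod_div_distrib]
  · have hpow : ∀ k, (q ^ 2) ^ (2 * k - 1) = q ^ (4 * k - 2) := fun k => by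
      rw [← pow_mul]
      congr 1
      omega
    have hne : ∀ j ∈ Finset.Icc 1 n, (q ^ 2) ^ (2 * s j - 1) + 1 ≠ 0 := fun j hj => by
      have hsj := (hpos j hj).2
      rw [hpow]
      exact pow_add_one_ne_zero_of_not_isOfFinOrder hq (by omega)
    rw [hform, Finset.prod_congr rfl fun j hj => qInt_factor_eq (q ^ 2) (hpos j hj).1 (hpos j hj).2
      (hne j hj), Finset.prod_mul_distrib, Finset.prod_mul_distrib, prod_Icc_Ioc_comm,
      prod_Icc_Icc_comm]
    simp only [← mul_assoc, hpow]

theorem mainTheorem6 (x n : ℕ) (s : ℕ → ℕ)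
    (hs : ∀ i ∈ Set.Icc 1 n, 1 ≤ s i ∧ s i ≤ n + x)
    (hmono : StrictMonoOn s (Set.Icc 1 n))
    (q : RatFunc ℚ) (hq : q = RatFunc.X) :
    tilingGF (quarteredHexagon x n s) (wt₂ q) =
        (2 : RatFunc ℚ) ^ (-(n ^ 2 : ℤ)) *
        q ^ (-∑ i ∈ Finset.Icc 1 n, ((4 * i - 2) * s i - 2 * i ^ 2 - i + 1 : ℤ)) *
        (((∏ i ∈ Finset.Icc 1 n, qInt (q ^ 2) (2 * s i - 1)) *
          ∏ i ∈ Finset.Icc 1 n, ∏ j ∈ Finset.Ioc i n,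
            (qInt (q ^ 2) (2 * (s i + s j - 1)) * qInt (q ^ 2) (2 * (s j - s i)))) /
          ∏ i ∈ Finset.Icc 1 n, qFactorial (q ^ 2) (2 * i - 1)) ∧
    tilingGF (quarteredHexagon x n s) (wt₂ q) =
        (2 : RatFunc ℚ) ^ (-(n ^ 2 : ℤ)) *
        q ^ (-∑ i ∈ Finset.Icc 1 n, ((4 * i - 2) * s i - 2 * i ^ 2 - i + 1 : ℤ)) *
        (∏ i ∈ Finset.Icc 1 n, 1 / (q ^ (4 * s i - 2) + 1)) *
        (∏ i ∈ Finset.Icc 1 n, ∏ j ∈ Finset.Icc i n,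
          qInt (q ^ 2) (2 * (s i + s j - 1)) / qInt (q ^ 2) (i + j - 1)) *
        ∏ i ∈ Finset.Icc 1 n, ∏ j ∈ Finset.Ioc i n,
          qInt (q ^ 2) (2 * (s j - s i)) / qInt (q ^ 2) (j - i) := by
  subst hq
  exact mainTheorem6_general two_ne_zero x n s hs hmono _ RatFunc.X_ne_zero
    not_isOfFinOrder_ratFunc_X
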